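/- Let $G=(V,E)$ be a finite tree. Two elements of $D=V\cup E$ are adjacent if they are adjacent vertices, distinct edges with a common endpoint, or an edge and one of its endpoints. A total matching is a set of pairwise non-adjacent elements of $D$, and the total matching polytope $P_T(G)\subseteq\mathbb{R}^{D}$ is the convex hull of the characteristic vectors of the total matchings of $G$. Write vectors of $\mathbb{R}^D$ as $(x,y)$ with $x\in\mathbb{R}^V$, $y\in\mathbb{R}^E$, let $\delta(v)$ be the set of edges incident to $v$, and consider the node, edge and nonnegativity inequalities \begin{align*} x_v+\sum_{e\in\delta(v)}y_e&\le 1 && \text{for all } v\in V, &&(1)\\ x_v+x_w+y_e&\le 1 && \text{for all } e=\{v,w\}\in E, &&(2)\\ x_v\ge 0,\quad y_e&\ge 0 && \text{for all } v\in V,\ e\in E. &&(3) \end{align*} Then (1)--(3) is a complete description of $P_T(G)$, that is, $P_T(G)$ is exactly its set of solutions. An inequality of the system (1)--(3) is redundant (deleting it alone leaves the set of solutions unchanged) if and only if it is the node inequality (1) of a vertex of degree $1$. Omitting the node inequalities of all vertices of degree $1$, one obtains a complete and non-redundant description of $P_T(G)$: its set of solutions is $P_T(G)$, and deleting any one of its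 inequalities changes the set of solutions. -/

import Mathlib

namespace TotalMatching

variable {V : Type*}

/-- The elements of a graph: its vertices and its edges. -/
abbrev Element (G : SimpleGraph V) : Type _ := V ⊕ G.edgeSet

/-- Adjacency of elements: adjacent vertices, two distinct edges with a common endpoint, or an edge
and one of its endpoints. -/
def ElementAdj (G : SimpleGraph V) : Element G → Element G → Prop
  | Sum.inl v, Sum.inl w => G.Adj v w
  | Sum.inr e, Sum.inr f => e ≠ f ∧ ∃ v, v ∈ (e : Sym2 V) ∧ v ∈ (f : Sym2 V)
  | Sum.inl v, Sum.inr e => v ∈ (e : Sym2 V)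
  | Sum.inr e, Sum.inl v => v ∈ (e : Sym2 V)

/-- A total matching is a set of pairwise independent (that is, non-adjacent) elements. -/
def IsTotalMatching (G : SimpleGraph V) (T : Set (Element G)) : Prop :=
  T.Pairwise fun d d' => ¬ ElementAdj G d d'

/-- The characteristic vector of a set of elements. -/
noncomputable def charVec {G : SimpleGraph V} (T : Set (Element G)) : Element G → ℝ :=
  T.indicator 1

/-- The total matching polytope: the convex hull of the characteristic vectors of the total
matchings. -/
def polytope (G : SimpleGraph V) : Set (Element G → ℝ) :=
  convexHull ℝ {z | ∃ T : Set (Element G), IsTotalMatching G T ∧ z = charVec T}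

/-- The list of basic inequalities: one node inequality for each vertex, one edge inequality for
each edge, and one nonnegativity inequality for each element. -/
inductive BasicIneq (G : SimpleGraph V) : Type _
  | node (v : V) : BasicIneq G
  | edge (e : G.edgeSet) : BasicIneq G
  | nonneg (d : Element G) : BasicIneq G

/-- What each basic inequality says about a vector `z = (x, y)`, where `x v = z (Sum.inl v)` and
`y e = z (Sum.inr e)`. -/
def BasicIneq.Holds [Fintype V] [DecidableEq V] {G : SimpleGraph V} [DecidableRel G.Adj] :
    BasicIneq G → (Element G → ℝ) → Prop
  | .node v, z =>
      z (Sum.inl v) +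
        ∑ e ∈ Finset.univ.filter (fun e : G.edgeSet => v ∈ (e : Sym2 V)), z (Sum.inr e) ≤ 1
  | .edge e, z =>
      ∀ v w : V, (e : Sym2 V) = s(v, w) → z (Sum.inl v) + z (Sum.inl w) + z (Sum.inr e) ≤ 1
  | .nonneg d, z => 0 ≤ z d

/-- The set of solutions of a system of basic inequalities. -/
def solutions [Fintype V] [DecidableEq V] {G : SimpleGraph V} [DecidableRel G.Adj]
    (S : Set (BasicIneq G)) : Set (Element G → ℝ) :=
  {z | ∀ i ∈ S, i.Holds z}

/-- A member `i` of a system `S` is redundant in `S` if deleting it does not change the set of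
solutions. -/
def IsRedundant [Fintype V] [DecidableEq V] {G : SimpleGraph V} [DecidableRel G.Adj]
    (S : Set (BasicIneq G)) (i : BasicIneq G) : Prop :=
  solutions (S \ {i}) = solutions S

/-- The node inequalities at the vertices of degree one. -/
def leafNodeIneqs [Fintype V] (G : SimpleGraph V) [DecidableRel G.Adj] : Set (BasicIneq G) :=
  {i | ∃ v : V, G.degree v = 1 ∧ i = BasicIneq.node v}

end TotalMatching

/-!
Two elements of a tree are adjacent exactly when they lie together in one of the cliques behind the
inequalities: the star `{v} ∪ δ(v)` of a vertex or the triangle formed by an edge and its endpoints.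
Hence the characteristic vector of a total matching satisfies all inequalities, and so does every
point of the polytope.

The converse is the integrality of the clique relaxation of a chordal graph. Fix a root `r` and give
a vertex `v` the rank `2 * dist r v` and an edge the sum of the distances of its endpoints from `r`,
so that every edge comes strictly between its two endpoints. The neighbours of an element `d` among
the elements of no larger rank lie, together with `d`, in a single clique: the star of the upper
endpoint if `d` is an edge, the triangle of the edge to the parent if `d` is a vertex other than
`r`, and the star of `r` if `d = r` (`exists_clique_of_isTree`).

Now add the elements one at a time in order of rank, keeping the restriction of `z` to the elements
added so far inside the convex hull of the stable sets. When `d` is added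
and `K` consists of the earlier elements of its clique, the affine map
`x ↦ x + t * (1 - ∑ k ∈ K, x k) • e_d` sends the characteristic vector of a stable set to a convex
combination of stable sets, because the factor `1 - ∑ k ∈ K, x k` is `0` or `1` there, and for
`t = z d / (1 - ∑ k ∈ K, z k)` it sends the old restriction of `z` to the new one
(`indicator_insert_mem_convexHull`, `mem_convexHull_of_eliminationOrder`).

The node inequality of a leaf follows from the inequality of its only edge. Every other inequality
is violated by a vector that satisfies all the remaining ones (`exists_violating_only`).
-/

namespace TotalMatching

/-! ### Indicator vectors and cliques -/

section Chordal

variable {ι : Type*}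

lemma sum_indicator_eq_one {Q : Finset ι} {T : Set ι} (h : (↑Q ∩ T).Subsingleton) {t : ι}
    (htQ : t ∈ Q) (htT : t ∈ T) : ∑ q ∈ Q, T.indicator (1 : ι → ℝ) q = 1 := by
  rw [Finset.sum_eq_single_of_mem t htQ]
  · simp [htT]
  · intro b hb hbt
    exact Set.indicator_of_notMem (fun hbT => hbt (h ⟨hb, hbT⟩ ⟨htQ, htT⟩)) _

lemma sum_indicator_eq_zero {Q : Finset ι} {T : Set ι} (h : ∀ t ∈ Q, t ∉ T) :
    ∑ q ∈ Q, T.indicator (1 : ι → ℝ) q = 0 :=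
  Finset.sum_eq_zero fun q hq => Set.indicator_of_notMem (h q hq) _

lemma sum_indicator_le_one {Q : Finset ι} {T : Set ι} (h : (↑Q ∩ T).Subsingleton) :
    ∑ q ∈ Q, T.indicator (1 : ι → ℝ) q ≤ 1 := by
  by_cases hQ : ∃ t ∈ Q, t ∈ T
  · obtain ⟨t, htQ, htT⟩ := hQ
    exact (sum_indicator_eq_one h htQ htT).le
  · push Not at hQ
    rw [sum_indicator_eq_zero hQ]
    exact zero_le_one

lemma one_lt_sum_indicator {Q : Finset ι} {T : Set ι} {p q : ι} (hpq : p ≠ q) (hp : p ∈ Q)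
    (hpT : p ∈ T) (hq : q ∈ Q) (hqT : q ∈ T) : 1 < ∑ i ∈ Q, T.indicator (1 : ι → ℝ) i := by
  classical
  have h : ∑ i ∈ {p, q}, T.indicator (1 : ι → ℝ) i ≤ ∑ i ∈ Q, T.indicator (1 : ι → ℝ) i := by
    refine Finset.sum_le_sum_of_subset_of_nonneg ?_ fun i _ _ =>
      Set.indicator_nonneg (fun _ _ => zero_le_one) i
    grind
  rw [Finset.sum_pair hpq] at h
  simp only [hpT, hqT, Set.indicator_of_mem, Pi.one_apply] at h
  linarith

/-- A clique and a stable set have at most one element in common. -/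
lemma subsingleton_clique_inter_stable {R : ι → ι → Prop} {Q T : Set ι} (hQ : Q.Pairwise R)
    (hT : T.Pairwise fun a b => ¬ R a b) : (Q ∩ T).Subsingleton := by
  rintro a ⟨haQ, haT⟩ b ⟨hbQ, hbT⟩
  by_contra hab
  exact hT haT hbT hab (hQ haQ hbQ hab)

/-! ### Integrality of the clique relaxation along an elimination order -/

/-- The convex hull of the indicator vectors of the stable sets contained in `A`. -/
def stableHull (R : ι → ι → Prop) (A : Set ι) : Set (ι → ℝ) :=
  convexHull ℝ {x | ∃ T ⊆ A, T.Pairwise (fun a b => ¬ R a b) ∧ x = T.indicator 1}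

/-- Extension by one element `d` whose neighbours in `A` lie in a clique `Q` containing `d`. -/
lemma indicator_insert_mem_convexHull [DecidableEq ι] {R : ι → ι → Prop}
    (hR : ∀ a b, R a b → R b a)
    {A Q : Finset ι} {d : ι} (hd : d ∉ A) (hdQ : d ∈ Q) (hQ : (Q : Set ι).Pairwise R)
    (hAQ : ∀ a ∈ A, R d a → a ∈ Q) {z : ι → ℝ} (hz : ∀ i, 0 ≤ z i) (hzQ : ∑ q ∈ Q, z q ≤ 1)
    (hA : (A : Set ι).indicator z ∈ stableHull R A) :
    ((insert d A : Finset ι) : Set ι).indicator z ∈ stableHull R (insert d A : Finset ι) := by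
  set K : Finset ι := Q ∩ A with hK
  set s : ℝ := ∑ k ∈ K, z k with hs
  have hdK : d ∉ K := fun h => hd (Finset.mem_inter.1 h).2
  have hsd : s + z d ≤ 1 := by
    refine le_trans ?_ hzQ
    rw [add_comm, hs, ← Finset.sum_insert hdK]
    exact Finset.sum_le_sum_of_subset_of_nonneg (by grind) fun i _ _ => hz i
  have hd0 := hz d
  -- If `s = 1`, then `z d = 0` and `t` takes the value `0`, as it should.
  set t : ℝ := z d / (1 - s) with ht
  have ht0 : 0 ≤ t := div_nonneg hd0 (by linarith)
  have ht1 : t ≤ 1 := div_le_one_of_le₀ (by linarith) (by linarith)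
  have hts : t * (1 - s) = z d := by
    rcases eq_or_ne (1 - s) 0 with h | h
    · rw [h, mul_zero]; linarith
    · exact div_mul_cancel₀ _ h
  let L : (ι → ℝ) →ₗ[ℝ] (ι → ℝ) :=
    LinearMap.id - (t • ∑ k ∈ K, LinearMap.proj (R := ℝ) (φ := fun _ : ι => ℝ) k).smulRight
      (Pi.single d (1 : ℝ))
  let F : (ι → ℝ) →ᵃ[ℝ] (ι → ℝ) :=
    L.toAffineMap + AffineMap.const ℝ (ι → ℝ) (Pi.single d t : ι → ℝ)
  have hF : ∀ x, F x = x + (t * (1 - ∑ k ∈ K, x k)) • (Pi.single d 1 : ι → ℝ) := by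
    intro x
    ext i
    rcases eq_or_ne i d with rfl | hi
    · simp [F, L]; ring
    · simp [F, L, hi]
  have hFz : F ((A : Set ι).indicator z) = ((insert d A : Finset ι) : Set ι).indicator z := by
    have hsum : ∑ k ∈ K, (A : Set ι).indicator z k = s :=
      Finset.sum_congr rfl fun k hk =>
        Set.indicator_of_mem (Finset.mem_coe.2 (Finset.mem_inter.1 hk).2) z
    rw [hF, hsum, hts]
    ext i
    rcases eq_or_ne i d with rfl | hi
    · simp [hd]
    · simp [Set.indicator_apply, hi]
  rw [← hFz]
  have himage : F '' stableHull R A ⊆ stableHull R (insert d A : Finset ι) := by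
    unfold stableHull
    rw [F.image_convexHull]
    refine convexHull_min ?_ (convex_convexHull ℝ _)
    rintro _ ⟨_, ⟨T, hTA, hT, rfl⟩, rfl⟩
    have hT' : T.indicator 1 ∈ stableHull R (insert d A : Finset ι) :=
      subset_convexHull ℝ _ ⟨T, hTA.trans (by simp), hT, rfl⟩
    have hdT : d ∉ T := fun h => hd (hTA h)
    rw [hF]
    by_cases hTK : ∃ k ∈ K, k ∈ T
    · obtain ⟨k, hkK, hkT⟩ := hTK
      have hsub : ((K : Set ι) ∩ T).Subsingleton :=
        (subsingleton_clique_inter_stable hQ hT).anti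
          (Set.inter_subset_inter_left _ (by simp [hK]))
      rw [sum_indicator_eq_one hsub hkK hkT]
      simpa [stableHull] using hT'
    · push Not at hTK
      rw [sum_indicator_eq_zero hTK]
      have hT'' : (insert d T).indicator 1 ∈ stableHull R (insert d A : Finset ι) := by
        refine subset_convexHull ℝ _ ⟨insert d T, ?_, ?_, rfl⟩
        · rw [Finset.coe_insert]
          exact Set.insert_subset_insert hTA
        · refine Set.pairwise_insert.2 ⟨hT, ?_⟩
          intro b hb _
          have hbA : b ∈ A := hTA hb
          have hdb : ¬ R d b := fun hdb =>
            hTK b (Finset.mem_inter.2 ⟨hAQ b hbA hdb, hbA⟩) hb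
          exact ⟨hdb, fun hbd => hdb (hR b d hbd)⟩
      convert convex_convexHull ℝ _ hT' hT'' (sub_nonneg.2 ht1) ht0 (sub_add_cancel 1 t) using 1
      ext i
      rcases eq_or_ne i d with rfl | hi
      · simp [hdT]
      · by_cases hiT : i ∈ T <;> simp [hi, hiT]
  exact himage ⟨_, hA, rfl⟩

/-- A nonnegative vector lies in the convex hull of the stable sets if the elements can be ranked
so that each one forms, together with its neighbours of no larger rank, part of a clique whose
inequality holds. -/
lemma mem_convexHull_of_eliminationOrder [Fintype ι] {R : ι → ι → Prop}
    (hR : ∀ a b, R a b → R b a)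
    (rank : ι → ℕ) {z : ι → ℝ} (hz : ∀ i, 0 ≤ z i)
    (h : ∀ d, ∃ Q : Finset ι, d ∈ Q ∧ (Q : Set ι).Pairwise R ∧ ∑ q ∈ Q, z q ≤ 1 ∧
      ∀ a, R d a → rank a ≤ rank d → a ∈ Q) :
    z ∈ convexHull ℝ {x | ∃ T : Set ι, T.Pairwise (fun a b => ¬ R a b) ∧ x = T.indicator 1} := by
  classical
  have key : ∀ A : Finset ι, (A : Set ι).indicator z ∈ stableHull R A := by
    intro A
    induction A using Finset.induction_on_max_value rank with
    | empty => exact subset_convexHull ℝ _ ⟨∅, by simp, by simp, by simp⟩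
    | insert d A hd hmax ih =>
      obtain ⟨Q, hdQ, hQ, hzQ, hdeg⟩ := h d
      exact indicator_insert_mem_convexHull hR hd hdQ hQ
        (fun a ha hda => hdeg a hda (hmax a ha)) hz hzQ ih
  simpa [stableHull] using key Finset.univ

end Chordal

section Graph

variable {V : Type*} {G : SimpleGraph V}

/-! ### The elimination order of a tree -/

lemma exists_adj_of_mem {e : G.edgeSet} {v : V} (h : v ∈ (e : Sym2 V)) :
    ∃ w, (e : Sym2 V) = s(v, w) ∧ G.Adj v w := by
  obtain ⟨w, hw⟩ := h
  have := e.2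
  rw [hw, SimpleGraph.mem_edgeSet] at this
  exact ⟨w, hw, this⟩

/-- In a tree, a vertex has at most one neighbour that is closer to the root. -/
lemma eq_of_adj_of_dist_lt (hG : G.IsTree) {r u v w : V} (hv : G.Adj w v) (hu : G.Adj w u)
    (hdv : G.dist r v < G.dist r w) (hdu : G.dist r u < G.dist r w) : u = v := by
  classical
  obtain ⟨p, hp, hpl⟩ := hG.connected.exists_path_of_dist r w
  -- A neighbour of `w` that is not on the path `p` from `r` to `w` is farther from `r` than `w`.
  have key : ∀ x, G.Adj w x → G.dist r x < G.dist r w → x = p.penultimate := by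
    intro x hx hdx
    refine hG.isAcyclic.eq_penultimate_of_adj_end hp hx ?_
    by_contra hxp
    obtain ⟨q, hq, hql⟩ := hG.connected.exists_path_of_dist r x
    have hwq := hG.isAcyclic.mem_support_of_ne_mem_support_of_adj_of_isPath hq hp hx.symm hxp
    have := G.dist_le (q.takeUntil w hwq)
    have := q.length_takeUntil_le_length hwq
    omega
  rw [key u hu hdu, key v hv hdv]

/-- The position of an element in the elimination order of a tree rooted at `r`: a vertex has twice
its distance from `r`, an edge the sum of the distances of its endpoints. -/
noncomputable def rank (G : SimpleGraph V) (r : V) : Element G → ℕ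
  | Sum.inl v => 2 * G.dist r v
  | Sum.inr e => Sym2.lift ⟨fun a b => G.dist r a + G.dist r b, fun _ _ => add_comm _ _⟩ (e : Sym2 V)

lemma rank_inr {r v w : V} {e : G.edgeSet} (h : (e : Sym2 V) = s(v, w)) :
    rank G r (Sum.inr e) = G.dist r v + G.dist r w := by
  simp [rank, h]

/-! ### The cliques of elements behind the inequalities -/

lemma elementAdj_symm (G : SimpleGraph V) :
    ∀ a b, ElementAdj G a b → ElementAdj G b a := by
  rintro (v | e) (w | f) h
  · exact SimpleGraph.Adj.symm h
  · exact h
  · exact h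
  · exact ⟨h.1.symm, h.2.imp fun _ => And.symm⟩

variable [Fintype V] [DecidableEq V]

/-- An edge together with its two endpoints. -/
def edgeClique (e : G.edgeSet) : Finset (Element G) :=
  Finset.disjSum (Finset.univ.filter fun v => v ∈ (e : Sym2 V)) {e}

@[simp] lemma inl_mem_edgeClique {e : G.edgeSet} {w : V} :
    Sum.inl w ∈ edgeClique e ↔ w ∈ (e : Sym2 V) := by
  simp [edgeClique]

@[simp] lemma inr_mem_edgeClique {e f : G.edgeSet} : Sum.inr f ∈ edgeClique e ↔ f = e := by
  simp [edgeClique]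

lemma pairwise_edgeClique (e : G.edgeSet) :
    (edgeClique e : Set (Element G)).Pairwise (ElementAdj G) := by
  rintro (a | f) ha (b | g) hb hab <;>
    simp only [Finset.mem_coe, inl_mem_edgeClique, inr_mem_edgeClique] at ha hb
  · have hne : a ≠ b := fun h => hab (by rw [h])
    have he : (e : Sym2 V) = s(a, b) := (Sym2.mem_and_mem_iff hne).1 ⟨ha, hb⟩
    have := e.2
    rwa [he, SimpleGraph.mem_edgeSet] at this
  · subst hb; exact ha
  · subst ha; exact hb
  · exact absurd (by rw [ha, hb]) hab

variable [DecidableRel G.Adj]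

/-- A vertex together with the edges at it. -/
def nodeClique (G : SimpleGraph V) [DecidableRel G.Adj] (v : V) : Finset (Element G) :=
  Finset.disjSum {v} (Finset.univ.filter fun e : G.edgeSet => v ∈ (e : Sym2 V))

@[simp] lemma inl_mem_nodeClique {v w : V} : Sum.inl w ∈ nodeClique G v ↔ w = v := by
  simp [nodeClique]

@[simp] lemma inr_mem_nodeClique {v : V} {e : G.edgeSet} :
    Sum.inr e ∈ nodeClique G v ↔ v ∈ (e : Sym2 V) := by
  simp [nodeClique]

lemma pairwise_nodeClique (v : V) : (nodeClique G v : Set (Element G)).Pairwise (ElementAdj G) := by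
  rintro (a | e) ha (b | f) hb hab <;>
    simp only [Finset.mem_coe, inl_mem_nodeClique, inr_mem_nodeClique] at ha hb
  · exact absurd (by rw [ha, hb]) hab
  · subst ha; exact hb
  · subst hb; exact ha
  · exact ⟨fun h => hab (by rw [h]), v, ha, hb⟩

lemma holds_node_iff {v : V} {z : Element G → ℝ} :
    (BasicIneq.node v).Holds z ↔ ∑ d ∈ nodeClique G v, z d ≤ 1 := by
  simp [BasicIneq.Holds, nodeClique, Finset.sum_disjSum]

lemma holds_edge_iff {e : G.edgeSet} {z : Element G → ℝ} :
    (BasicIneq.edge e).Holds z ↔ ∑ d ∈ edgeClique e, z d ≤ 1 := by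
  have key : ∀ v w : V, (e : Sym2 V) = s(v, w) →
      ∑ d ∈ edgeClique e, z d = z (Sum.inl v) + z (Sum.inl w) + z (Sum.inr e) := by
    intro v w h
    have hadj := e.2
    rw [h, SimpleGraph.mem_edgeSet] at hadj
    have hfil : (Finset.univ.filter fun u => u ∈ (e : Sym2 V)) = {v, w} := by
      ext u; simp [h]
    rw [edgeClique, Finset.sum_disjSum, hfil, Finset.sum_pair hadj.ne, Finset.sum_singleton]
  constructor
  · intro h
    obtain ⟨v, w, hvw⟩ : ∃ v w, (e : Sym2 V) = s(v, w) :=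
      Sym2.ind (f := fun p => ∃ v w, p = s(v, w)) (fun v w => ⟨v, w, rfl⟩) _
    rw [key v w hvw]
    exact h v w hvw
  · intro h v w hvw
    rwa [← key v w hvw]

/-! ### Completeness -/

lemma polytope_subset_solutions (S : Set (BasicIneq G)) : polytope G ⊆ solutions S := by
  have hconv : ∀ Q : Finset (Element G), Convex ℝ {z : Element G → ℝ | ∑ q ∈ Q, z q ≤ 1} :=
    fun Q => convex_halfSpace_le
      ⟨fun _ _ => Finset.sum_add_distrib, fun _ _ => (Finset.mul_sum ..).symm⟩ 1
  intro z hz i _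
  rcases i with v | e | d
  · rw [holds_node_iff]
    refine convexHull_min (t := {z | ∑ q ∈ nodeClique G v, z q ≤ 1}) ?_ (hconv _) hz
    rintro _ ⟨T, hT, rfl⟩
    exact sum_indicator_le_one (subsingleton_clique_inter_stable (pairwise_nodeClique v) hT)
  · rw [holds_edge_iff]
    refine convexHull_min (t := {z | ∑ q ∈ edgeClique e, z q ≤ 1}) ?_ (hconv _) hz
    rintro _ ⟨T, hT, rfl⟩
    exact sum_indicator_le_one (subsingleton_clique_inter_stable (pairwise_edgeClique e) hT)
  · refine convexHull_min (t := {z : Element G → ℝ | 0 ≤ z d}) ?_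
      (convex_halfSpace_ge ⟨fun _ _ => rfl, fun _ _ => rfl⟩ 0) hz
    rintro _ ⟨T, _, rfl⟩
    exact Set.indicator_nonneg (fun _ _ => zero_le_one (α := ℝ)) d

/-- In a tree, an element and its neighbours of no larger rank lie in a common clique: the star of
a vertex or the triangle of an edge. -/
lemma exists_clique_of_isTree (hG : G.IsTree) (r : V) {z : Element G → ℝ}
    (hz : z ∈ solutions (Set.univ : Set (BasicIneq G))) (d : Element G) :
    ∃ Q : Finset (Element G), d ∈ Q ∧ (Q : Set (Element G)).Pairwise (ElementAdj G) ∧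
      ∑ q ∈ Q, z q ≤ 1 ∧ ∀ a, ElementAdj G d a → rank G r a ≤ rank G r d → a ∈ Q := by
  have hnode := fun v => holds_node_iff.1 (hz (.node v) trivial)
  have hedge := fun e => holds_edge_iff.1 (hz (.edge e) trivial)
  rcases d with w | e
  · by_cases hpar : ∃ v, G.Adj w v ∧ G.dist r v < G.dist r w
    · obtain ⟨v, hwv, hlt⟩ := hpar
      refine ⟨edgeClique ⟨s(w, v), hwv⟩, by simp, pairwise_edgeClique _, hedge _, ?_⟩
      rintro (u | f) ha hr
      · change G.Adj w u at ha
        have := hG.dist_ne_of_adj r ha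
        simp only [rank] at hr
        simp [eq_of_adj_of_dist_lt hG hwv ha hlt (by omega)]
      · obtain ⟨u, hf, hadj⟩ := exists_adj_of_mem ha
        rw [rank_inr hf] at hr
        simp only [rank] at hr
        have := hG.dist_ne_of_adj r hadj
        have huv := eq_of_adj_of_dist_lt hG hwv hadj hlt (by omega)
        rw [inr_mem_edgeClique, Subtype.ext_iff, hf, huv]
    -- Without a parent, all neighbours of `w` have larger rank, and the star of `w` will do.
    · push Not at hpar
      refine ⟨nodeClique G w, by simp, pairwise_nodeClique w, hnode w, ?_⟩
      rintro (u | f) ha hr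
      · change G.Adj w u at ha
        have h1 := hG.dist_ne_of_adj r ha
        have h2 := hpar u ha
        simp only [rank] at hr
        omega
      · exact inr_mem_nodeClique.2 ha
  · obtain ⟨v, w, he, hvw, hlt⟩ : ∃ v w, (e : Sym2 V) = s(v, w) ∧ G.Adj v w ∧
        G.dist r v < G.dist r w := by
      obtain ⟨v, w, he, hadj⟩ : ∃ v w, (e : Sym2 V) = s(v, w) ∧ G.Adj v w :=
        ⟨_, exists_adj_of_mem (Sym2.out_fst_mem (e : Sym2 V))⟩
      rcases lt_or_gt_of_ne (hG.dist_ne_of_adj r hadj) with h | h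
      · exact ⟨v, w, he, hadj, h⟩
      · exact ⟨w, v, he.trans Sym2.eq_swap, hadj.symm, h⟩
    refine ⟨nodeClique G v, by simp [he], pairwise_nodeClique v, hnode v, ?_⟩
    rintro (u | f) ha hr
    · change u ∈ (e : Sym2 V) at ha
      rw [he, Sym2.mem_iff] at ha
      rw [rank_inr he] at hr
      simp only [rank] at hr
      rcases ha with rfl | rfl
      · simp
      · omega
    · obtain ⟨-, x, hxe, hxf⟩ := ha
      rw [inr_mem_nodeClique]
      rw [he, Sym2.mem_iff] at hxe
      rcases hxe with rfl | rfl
      · exact hxf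
      · obtain ⟨u, hf, hadj⟩ := exists_adj_of_mem hxf
        rw [rank_inr he, rank_inr hf] at hr
        rw [hf, ← eq_of_adj_of_dist_lt hG hadj hvw.symm (by omega) hlt]
        simp

lemma polytope_eq_solutions_univ (hG : G.IsTree) :
    polytope G = solutions (Set.univ : Set (BasicIneq G)) := by
  refine (polytope_subset_solutions _).antisymm fun z hz => ?_
  obtain ⟨r⟩ := hG.connected.nonempty
  exact mem_convexHull_of_eliminationOrder (elementAdj_symm G) (rank G r)
    (fun d => hz (.nonneg d) trivial) (exists_clique_of_isTree hG r hz)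

/-! ### Redundancy -/

lemma solutions_anti {S S' : Set (BasicIneq G)} (h : S ⊆ S') : solutions S' ⊆ solutions S :=
  fun _ hz i hi => hz i (h hi)

/-- The node inequality of a leaf follows from the inequality of its edge and nonnegativity. -/
lemma solutions_compl_leafNodeIneqs :
    solutions (leafNodeIneqs G)ᶜ = solutions (Set.univ : Set (BasicIneq G)) := by
  refine Set.Subset.antisymm (fun z hz => ?_) (solutions_anti (Set.subset_univ _))
  have hnonneg : ∀ d, 0 ≤ z d := fun d => hz (.nonneg d) (by simp [leafNodeIneqs])
  intro i _
  by_cases hi : i ∈ leafNodeIneqs G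
  · obtain ⟨v, hv, rfl⟩ := hi
    obtain ⟨w, hvw, huniq⟩ := G.degree_eq_one_iff_existsUnique_adj.1 hv
    have hedge := holds_edge_iff.1 (hz (.edge ⟨s(v, w), hvw⟩) (by simp [leafNodeIneqs]))
    rw [holds_node_iff]
    refine le_trans (Finset.sum_le_sum_of_subset_of_nonneg ?_ fun d _ _ => hnonneg d) hedge
    rintro (u | f) ha
    · simp_all
    · rw [inr_mem_nodeClique] at ha
      obtain ⟨u, hf, hadj⟩ := exists_adj_of_mem ha
      rw [inr_mem_edgeClique, Subtype.ext_iff, hf, huniq u hadj]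
  · exact hz i hi

/-- Apart from the node inequalities of the leaves, each inequality is violated by a vector that
satisfies all the others. -/
lemma exists_violating_only {i : BasicIneq G} (hi : i ∉ leafNodeIneqs G) :
    ∃ z : Element G → ℝ, ¬ i.Holds z ∧ ∀ j, j ≠ i → j.Holds z := by
  have hind : ∀ (T : Set (Element G)) d, (0 : ℝ) ≤ T.indicator 1 d := fun T d =>
    Set.indicator_nonneg (fun _ _ => zero_le_one) d
  rcases i with v | e | d
  · have hdeg : G.degree v ≠ 1 := fun h => hi ⟨v, h, rfl⟩
    rcases Nat.eq_zero_or_pos (G.degree v) with h0 | hpos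
    -- At an isolated vertex, `v` is in no inequality other than `x v ≤ 1` and `0 ≤ x v`.
    · have hno : ∀ e : G.edgeSet, v ∉ (e : Sym2 V) := fun e he => by
        obtain ⟨w, -, hw⟩ := exists_adj_of_mem he
        exact absurd h0 ((G.degree_pos_iff_exists_adj v).2 ⟨w, hw⟩).ne'
      refine ⟨Pi.single (Sum.inl v) 2, ?_, ?_⟩
      · rw [holds_node_iff, Finset.sum_pi_single']
        norm_num
      · rintro (w | e | d) hj
        · rw [holds_node_iff, Finset.sum_pi_single', if_neg]
          · exact zero_le_one
          · rw [inl_mem_nodeClique]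
            rintro rfl
            exact hj rfl
        · rw [holds_edge_iff, Finset.sum_pi_single', if_neg (by simp [hno])]
          exact zero_le_one
        · exact (Pi.single_nonneg.2 zero_le_two : (0 : Element G → ℝ) ≤ _) d
    -- Otherwise two edges at `v` have no other clique in common.
    · obtain ⟨a, ha, b, hb, hab⟩ := Finset.one_lt_card.1
        (show 1 < (G.neighborFinset v).card by rw [G.card_neighborFinset_eq_degree]; omega)
      rw [SimpleGraph.mem_neighborFinset] at ha hb
      let e : G.edgeSet := ⟨s(v, a), ha⟩
      let f : G.edgeSet := ⟨s(v, b), hb⟩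
      have hef : e ≠ f := fun h => hab (Sym2.congr_right.1 (Subtype.ext_iff.1 h))
      refine ⟨({Sum.inr e, Sum.inr f} : Set (Element G)).indicator 1, ?_, ?_⟩
      · rw [holds_node_iff, not_le]
        exact one_lt_sum_indicator (p := Sum.inr e) (q := Sum.inr f) (by simpa using hef)
          (by simp [e]) (by simp) (by simp [f]) (by simp)
      · rintro (w | g | d) hj
        · have hwv : w ≠ v := fun h => hj (by rw [h])
          rw [holds_node_iff]
          refine sum_indicator_le_one ?_
          have hnot : w ∈ (e : Sym2 V) → w ∉ (f : Sym2 V) := by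
            simp only [e, f, Sym2.mem_iff]
            rintro (h | rfl) (h' | h')
            exacts [hwv h, hwv h, hwv h', hab h']
          rintro _ ⟨hx, rfl | rfl⟩ _ ⟨hy, rfl | rfl⟩ <;> simp_all
        · rw [holds_edge_iff]
          refine sum_indicator_le_one ?_
          rintro _ ⟨hx, rfl | rfl⟩ _ ⟨hy, rfl | rfl⟩ <;>
            simp only [Finset.mem_coe, inr_mem_edgeClique] at hx hy <;> simp only [hx, hy]
        · exact hind _ d
  · obtain ⟨v, w, he, hvw⟩ : ∃ v w, (e : Sym2 V) = s(v, w) ∧ G.Adj v w :=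
      ⟨_, exists_adj_of_mem (Sym2.out_fst_mem (e : Sym2 V))⟩
    refine ⟨({Sum.inl v, Sum.inl w} : Set (Element G)).indicator 1, ?_, ?_⟩
    · rw [holds_edge_iff, not_le]
      exact one_lt_sum_indicator (p := Sum.inl v) (q := Sum.inl w) (by simpa using hvw.ne)
        (by simp [he]) (by simp) (by simp [he]) (by simp)
    · rintro (u | g | d) hj
      · rw [holds_node_iff]
        refine sum_indicator_le_one ?_
        rintro _ ⟨hx, rfl | rfl⟩ _ ⟨hy, rfl | rfl⟩ <;>
          simp only [Finset.mem_coe, inl_mem_nodeClique] at hx hy <;> simp only [hx, hy]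
      · rw [holds_edge_iff]
        refine sum_indicator_le_one ?_
        have hnot : v ∈ (g : Sym2 V) → w ∉ (g : Sym2 V) := fun h1 h2 => by
          refine hj (congrArg _ (Subtype.ext ?_))
          rw [he]
          exact (Sym2.mem_and_mem_iff hvw.ne).1 ⟨h1, h2⟩
        rintro _ ⟨hx, rfl | rfl⟩ _ ⟨hy, rfl | rfl⟩ <;> simp_all
      · exact hind _ d
  · refine ⟨Pi.single d (-1), ?_, ?_⟩
    · simp [BasicIneq.Holds]
    · rintro (v | e | d') hj
      · rw [holds_node_iff, Finset.sum_pi_single']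
        split_ifs <;> norm_num
      · rw [holds_edge_iff, Finset.sum_pi_single']
        split_ifs <;> norm_num
      · have : d' ≠ d := fun h => hj (by rw [h])
        simp [BasicIneq.Holds, this]

lemma not_isRedundant {S : Set (BasicIneq G)} {i : BasicIneq G} (hiS : i ∈ S)
    (hi : i ∉ leafNodeIneqs G) : ¬ IsRedundant S i := by
  obtain ⟨z, hzi, hz⟩ := exists_violating_only hi
  intro h
  have hmem : z ∈ solutions (S \ {i}) := fun j hj => hz j hj.2
  rw [IsRedundant] at h
  rw [h] at hmem
  exact hzi (hmem i hiS)

lemma isRedundant_univ_iff {i : BasicIneq G} :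
    IsRedundant Set.univ i ↔ i ∈ leafNodeIneqs G := by
  refine ⟨fun h => by_contra fun hi => not_isRedundant (Set.mem_univ i) hi h, fun hi => ?_⟩
  refine Set.Subset.antisymm ?_ (solutions_anti (Set.subset_univ _))
  rw [← solutions_compl_leafNodeIneqs]
  refine solutions_anti fun j hj => ⟨Set.mem_univ j, ?_⟩
  rintro rfl
  exact hj hi

end Graph

end TotalMatching

theorem mainTheorem2 {V : Type*} [Fintype V] [DecidableEq V]
    (G : SimpleGraph V) [DecidableRel G.Adj] (hG : G.IsTree) :
    -- all the basic inequalities together are a complete description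
    TotalMatching.polytope G = TotalMatching.solutions (Set.univ : Set (TotalMatching.BasicIneq G)) ∧
    -- the only redundant ones among them are the node inequalities at the leaves
    (∀ i : TotalMatching.BasicIneq G,
      TotalMatching.IsRedundant Set.univ i ↔ i ∈ TotalMatching.leafNodeIneqs G) ∧
    -- without these, the description is still complete, and it is non-redundant
    TotalMatching.polytope G = TotalMatching.solutions (TotalMatching.leafNodeIneqs G)ᶜ ∧
    (∀ i ∈ (TotalMatching.leafNodeIneqs G)ᶜ,
      ¬ TotalMatching.IsRedundant (TotalMatching.leafNodeIneqs G)ᶜ i) := by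

  exact ⟨TotalMatching.polytope_eq_solutions_univ hG,
    fun _ => TotalMatching.isRedundant_univ_iff,
    (TotalMatching.polytope_eq_solutions_univ hG).trans
      TotalMatching.solutions_compl_leafNodeIneqs.symm,
    fun _ hi => TotalMatching.not_isRedundant hi hi⟩
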